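/- Fix integers $n\ge 1$ and $k\ge 0$. A learning algorithm with $n+k$ qubit registers (that is, with $k$ qubits of quantum memory and unlimited classical memory) using $T$ copies of an unknown $n$-qubit state $\rho$ is the following adaptive protocol. The $k$-qubit memory starts in some state $\Sigma_0$. In each of $T$ rounds a fresh copy of $\rho$ is placed in the $n$ non-memory registers. If the memory is then in the (unnormalized) state $\Sigma$, all $n+k$ registers are measured with a finite-outcome measurement $\{M_s\}_s$, $\sum_s M_s^\dagger M_s=I$, chosen depending on all previous outcomes. Outcome $s$ leaves the memory in the unnormalized state $\mathrm{tr}_{1,\dots,n}\big(M_s(\rho\otimes\Sigma)M_s^\dagger\big)$, whose trace is the probability of the transcript so far. After the $T$ rounds an observable $O\in\{I,X,Y,Z\}^{\otimes n}\setminus\{I^{\otimes n}\}$ is revealed. The algorithm then outputs a real number obtained from a measurement of the remaining $k$-qubit memory, where both the measurement and the output may depend on $O$ and on the transcript. Task: with probability $1/2$, $\rho=I/2^n$ and $O$ is a uniformly random non-identity Pauli string. With probability $1/2$, $\rho=(I+P)/2^n$ for a uniformly random non-identity Pauli string $P$, and $O=P$. The algorithm succeeds if its output equals $|\mathrm{tr}(O\rho)|$;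 the success probability is taken over the choice of case, the random Pauli string and the measurement outcomes. (i) There is an absolute constant $c>0$ such that, for all $n\ge 1$ and $k,T\ge 0$, every learning algorithm with $n+k$ qubit registers that succeeds at the task with probability at least $2/3$ using $T$ copies satisfies $T\ge c\,2^{(n-k)/3}$. (ii) For $k=n$ the task is solvable with $O(1)$ copies: for every $\delta>0$ there is a number $T$ of copies, independent of $n$, such that for every $n\ge 1$ some learning algorithm with $2n$ qubit registers using $T$ copies succeeds with probability at least $1-\delta$. -/

import Mathlib

open scoped Kronecker ComplexOrder

noncomputable section

namespace ShadowTomography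

/-- Labels of the computational basis of `m` qubits. -/
abbrev Qubits (m : ℕ) : Type := Fin m → Fin 2

/-- Operators on `m` qubits. -/
abbrev Op (m : ℕ) : Type := Matrix (Qubits m) (Qubits m) ℂ

/-- Operators on `n + k` qubit registers: the first `n` registers hold the incoming copy of the
unknown state, the remaining `k` registers are the quantum memory. -/
abbrev JointOp (n k : ℕ) : Type := Matrix (Qubits n × Qubits k) (Qubits n × Qubits k) ℂ

/-- The single-qubit Pauli matrices `I, X, Y, Z` (in this order). -/
def pauli : Fin 4 → Matrix (Fin 2) (Fin 2) ℂ :=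
  ![1, !![0, 1; 1, 0], !![0, -Complex.I; Complex.I, 0], !![1, 0; 0, -1]]

/-- The `n`-qubit Pauli strings different from the identity string. -/
abbrev NonIdPauli (n : ℕ) : Type := {P : Fin n → Fin 4 // P ≠ fun _ => 0}

/-- The operator `σ_{P 0} ⊗ ⋯ ⊗ σ_{P (n-1)}` of a Pauli string. -/
def pauliOp {n : ℕ} (P : Fin n → Fin 4) : Op n :=
  Matrix.of fun x y => ∏ i, pauli (P i) (x i) (y i)

/-- Density matrices: positive semidefinite with unit trace. -/
def IsDensity {m : ℕ} (ρ : Op m) : Prop := ρ.PosSemidef ∧ ρ.trace = 1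

/-- The maximally mixed state `I / 2^n`. -/
def mixedState (n : ℕ) : Op n := ((2 : ℂ) ^ n)⁻¹ • (1 : Op n)

/-- The state `(I + P) / 2^n`. -/
def pauliState {n : ℕ} (P : Fin n → Fin 4) : Op n := ((2 : ℂ) ^ n)⁻¹ • (1 + pauliOp P)

/-- The partial trace over the first `n` registers. -/
def traceFirst {n k : ℕ} (X : JointOp n k) : Op k :=
  Matrix.of fun a b => ∑ x, X (x, a) (x, b)

/-- The unnormalized state `tr_{1,…,n}(M (ρ ⊗ Σ) M†)` of the quantum memory after the measurement
outcome with operator `M`, when a copy of `ρ` arrives and the memory is in the state `S`. -/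
def memoryUpdate {n k : ℕ} (M : JointOp n k) (ρ : Op n) (S : Op k) : Op k :=
  traceFirst (M * (ρ ⊗ₖ S) * M.conjTranspose)

/-- Learning trees of depth `T` on `n + k` qubit registers.

At an inner node one copy of the unknown state is received and the `n + k` registers are measured
with a POVM `F_s = M_s† M_s`, chosen according to the transcript so far (that is, the node); outcome
`s` leads to the `s`-th child. At a leaf the learning phase is over. The observable `O` is revealed,
the remaining `k`-qubit memory is measured with a POVM `E O` that may depend on `O` (and on the
leaf), and outcome `j` makes the algorithm output the real number `answer O j`. -/
inductive LearningTree (n k : ℕ) : ℕ → Type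
  | leaf (m : ℕ) (E : NonIdPauli n → Fin m → Op k)
      (posSemidef : ∀ O j, (E O j).PosSemidef)
      (complete : ∀ O, ∑ j, E O j = 1)
      (answer : NonIdPauli n → Fin m → ℝ) : LearningTree n k 0
  | node {T : ℕ} (N : ℕ) (M : Fin N → JointOp n k)
      (complete : ∑ s, (M s).conjTranspose * M s = 1)
      (child : Fin N → LearningTree n k T) : LearningTree n k (T + 1)

/-- The probability that the output equals `v`, when the copies received are `ρ`, the revealed
observable is `O`, and the memory starts in the (possibly unnormalized) state `S`. -/
def LearningTree.probOutput {n k : ℕ} (ρ : Op n) (O : NonIdPauli n) (v : ℝ) :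
    {T : ℕ} → LearningTree n k T → Op k → ℝ
  | _, .leaf _ E _ _ answer, S =>
      ∑ j, if answer O j = v then ((E O j * S).trace).re else 0
  | _, .node _ M _ child, S =>
      ∑ s, (child s).probOutput ρ O v (memoryUpdate (M s) ρ S)

/-- A learning algorithm with `n + k` qubit registers, `k` of which are quantum memory, unbounded
classical memory, and `T` copies of the unknown `n`-qubit state. -/
structure LearningAlgorithm (n k T : ℕ) where
  /-- The initial state of the quantum memory. -/
  init : Op k
  init_isDensity : IsDensity init
  tree : LearningTree n k T

/-- The probability that the algorithm outputs `|tr(O ρ)|`. -/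
def LearningAlgorithm.probCorrect {n k T : ℕ} (A : LearningAlgorithm n k T)
    (ρ : Op n) (O : NonIdPauli n) : ℝ :=
  A.tree.probOutput ρ O ‖(pauliOp O.1 * ρ).trace‖ A.init

/-- The success probability in the task: with probability `1/2` the unknown state is `I / 2^n` and
`O` is a uniformly random non-identity Pauli string; with probability `1/2` the unknown state is
`(I + P) / 2^n` for a uniformly random non-identity Pauli string `P`, and `O = P`. -/
def LearningAlgorithm.successProb {n k T : ℕ} (A : LearningAlgorithm n k T) : ℝ :=
  1 / 2 * ((∑ O : NonIdPauli n, A.probCorrect (mixedState n) O) / Fintype.card (NonIdPauli n))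
    + 1 / 2 * ((∑ P : NonIdPauli n, A.probCorrect (pauliState P.1) P)
        / Fintype.card (NonIdPauli n))

end ShadowTomography

end

open scoped Kronecker ComplexOrder

noncomputable section

namespace ShadowTomography

variable {n k : ℕ}

/-! ### Pauli strings -/

/-! Lower bound, by a hybrid argument. Write `(I + P)/2^n` as the maximally mixed state plus the
perturbation `P/2^n`, and exchange the copies one round at a time. The error made in a round is the
output probability of the remaining tree, applied to the memory update of `P/2^n`; the memory
entering that round has seen only mixed copies and so does not depend on `P`. Two facts control this
error on average over `P`. Pauli strings are an orthogonal basis of the operators, so Parseval and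
Cauchy–Schwarz bound the squared Frobenius norms of the updates, summed over `P`, by `2^n w^2`,
where `w` is the trace of the update of the identity (`sum_norm_sq_memoryUpdate_pauliOp_le`). The
remaining tree is a positive functional dominated by the trace on a space of dimension only `2^k`,
so its value is controlled by the Frobenius norm (`le_of_posSemidef_functional`). Together they give
an average advantage of order `T 2^((k-n)/2)`, whereas success probability `2/3` needs a constant
one. This yields exponent `1/2`, stronger than the claimed `1/3`.

Upper bound: store one copy and measure it jointly with the next in the Bell basis, which
diagonalizes every `O ⊗ O` with eigenvalues `±1`. Two copies of `(I + O)/2^n` always give eigenvalue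
`1`; two mixed copies give a uniform Bell state, hence eigenvalue `1` with probability `1/2`. After
`m` pairs the only possible error is a false positive, of probability `2^(-m)`. -/

lemma sum_prod_apply {ι α : Type*} [Fintype ι] [DecidableEq ι] [Fintype α] (f : ι → α → ℂ) :
    ∑ x : ι → α, ∏ i, f i (x i) = ∏ i, ∑ a, f i a := by
  rw [Finset.prod_univ_sum, Fintype.piFinset_univ]

lemma prod_ite_eq_eq (c : ℂ) (x y x' y' : Qubits n) :
    ∏ i, (if x i = x' i ∧ y i = y' i then c else 0) =
      if x = x' ∧ y = y' then c ^ n else 0 := by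
  split_ifs with h
  · obtain ⟨rfl, rfl⟩ := h
    simp
  · rw [Finset.prod_eq_zero_iff]
    by_contra! hne
    exact h ⟨funext fun i => by_contra fun hi => hne i (Finset.mem_univ i) (by simp [hi]),
      funext fun i => by_contra fun hi => hne i (Finset.mem_univ i) (by simp [hi])⟩

lemma sum_pauli_mul_star (a b a' b' : Fin 2) :
    ∑ j, pauli j a b * star (pauli j a' b') = if a = a' ∧ b = b' then 2 else 0 := by
  fin_cases a <;> fin_cases b <;> fin_cases a' <;> fin_cases b' <;>
    simp [pauli, Fin.sum_univ_four] <;> norm_num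

/-- The Pauli strings, divided by `√(2^n)`, form an orthonormal basis of the operators. -/
lemma sum_pauliOp_mul_star (x y x' y' : Qubits n) :
    ∑ P : Fin n → Fin 4, pauliOp P x y * star (pauliOp P x' y') =
      if x = x' ∧ y = y' then (2 : ℂ) ^ n else 0 := by
  simp only [pauliOp, Matrix.of_apply, star_prod, ← Finset.prod_mul_distrib]
  rw [sum_prod_apply (fun i j => pauli j (x i) (y i) * star (pauli j (x' i) (y' i)))]
  simp only [sum_pauli_mul_star, prod_ite_eq_eq]

lemma star_pauli (j : Fin 4) (a b : Fin 2) : star (pauli j b a) = pauli j a b := by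
  fin_cases j <;> fin_cases a <;> fin_cases b <;> simp [pauli]

lemma isHermitian_pauliOp (P : Fin n → Fin 4) : (pauliOp P).IsHermitian := by
  ext x y
  simp [pauliOp, ← star_pauli (_) (x _) (y _)]

lemma pauliOp_zero : pauliOp (fun _ : Fin n => (0 : Fin 4)) = 1 := by
  ext x y
  simp only [pauliOp, Matrix.of_apply, pauli, Matrix.cons_val_zero, Matrix.one_apply]
  split_ifs with hxy
  · simp [hxy]
  · obtain ⟨i, hi⟩ := Function.ne_iff.1 hxy
    exact Finset.prod_eq_zero (Finset.mem_univ i) (by simp [hi])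

lemma trace_pauliOp_mul (P Q : Fin n → Fin 4) :
    (pauliOp P * pauliOp Q).trace = if P = Q then 2 ^ n else 0 := by
  have single : ∀ p q : Fin 4, ∑ a, ∑ b, pauli p a b * pauli q b a = if p = q then 2 else 0 := by
    intro p q
    fin_cases p <;> fin_cases q <;> simp [pauli] <;> norm_num
  simp only [Matrix.trace, Matrix.diag, Matrix.mul_apply, pauliOp, Matrix.of_apply,
    ← Finset.prod_mul_distrib]
  have h : ∀ x : Qubits n, ∑ y : Qubits n, ∏ i, pauli (P i) (x i) (y i) * pauli (Q i) (y i) (x i) =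
      ∏ i, ∑ b, pauli (P i) (x i) b * pauli (Q i) b (x i) := fun x =>
    sum_prod_apply (fun i b => pauli (P i) (x i) b * pauli (Q i) b (x i))
  simp only [h]
  rw [sum_prod_apply (fun i a => ∑ b, pauli (P i) a b * pauli (Q i) b a)]
  simp only [single]
  split_ifs with hPQ
  · simp [hPQ]
  · obtain ⟨i, hi⟩ := Function.ne_iff.1 hPQ
    exact Finset.prod_eq_zero (Finset.mem_univ i) (by simp [hi])

lemma trace_pauliOp (P : NonIdPauli n) : (pauliOp P.1).trace = 0 := by
  simpa [pauliOp_zero, P.2] using trace_pauliOp_mul P.1 (fun _ => 0)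

lemma trace_mixedState (n : ℕ) : (mixedState n).trace = 1 := by
  simp [mixedState, Matrix.trace_smul, Matrix.trace_one]

lemma posSemidef_mixedState (n : ℕ) : (mixedState n).PosSemidef := by
  refine Matrix.PosSemidef.one.smul ?_
  rw [← Complex.ofReal_ofNat, ← Complex.ofReal_pow, ← Complex.ofReal_inv, Complex.zero_le_real]
  positivity

lemma pauliState_eq (P : Fin n → Fin 4) :
    pauliState P = mixedState n + ((2 : ℂ) ^ n)⁻¹ • pauliOp P := by
  simp [pauliState, mixedState]

lemma trace_pauliState (P : NonIdPauli n) : (pauliState P.1).trace = 1 := by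
  simp [pauliState_eq, Matrix.trace_add, trace_mixedState, Matrix.trace_smul, trace_pauliOp]

lemma pauliOp_mul_self (P : Fin n → Fin 4) : pauliOp P * pauliOp P = 1 := by
  have single : ∀ (p : Fin 4) (a c : Fin 2), ∑ b, pauli p a b * pauli p b c = pauli 0 a c := by
    intro p a c
    fin_cases p <;> fin_cases a <;> fin_cases c <;> simp [pauli]
  rw [← pauliOp_zero]
  ext x z
  simp only [Matrix.mul_apply, pauliOp, Matrix.of_apply, ← Finset.prod_mul_distrib]
  rw [sum_prod_apply (fun i b => pauli (P i) (x i) b * pauli (P i) b (z i))]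
  simp only [single]

lemma posSemidef_pauliState (P : Fin n → Fin 4) : (pauliState P).PosSemidef := by
  -- Since `P` is a Hermitian involution, `1 + P` is twice a projection.
  have h : pauliState P =
      ((2 : ℂ) ^ (n + 1))⁻¹ • ((1 + pauliOp P).conjTranspose * (1 + pauliOp P)) := by
    rw [Matrix.conjTranspose_add, Matrix.conjTranspose_one, (isHermitian_pauliOp P).eq]
    have h2 : (1 + pauliOp P) * (1 + pauliOp P) = (2 : ℂ) • (1 + pauliOp P) := by
      rw [add_mul, mul_add, mul_add, pauliOp_mul_self, two_smul]
      simp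
      abel
    rw [h2, smul_smul, pauliState]
    congr 1
    field_simp
    ring
  rw [h]
  refine (Matrix.posSemidef_conjTranspose_mul_self _).smul ?_
  rw [← Complex.ofReal_ofNat, ← Complex.ofReal_pow, ← Complex.ofReal_inv, Complex.zero_le_real]
  positivity

/-! ### The update of the quantum memory -/

lemma memoryUpdate_apply (M : JointOp n k) (ρ : Op n) (S : Op k) (a b : Qubits k) :
    memoryUpdate M ρ S a b = ∑ x, ∑ q : Qubits n × Qubits k, ∑ p : Qubits n × Qubits k,
      M (x, a) p * (ρ p.1 q.1 * S p.2 q.2) * star (M (x, b) q) := by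
  simp [memoryUpdate, traceFirst, Matrix.mul_apply, Finset.sum_mul, Matrix.kroneckerMap_apply]

lemma traceFirst_add (X Y : JointOp n k) : traceFirst (X + Y) = traceFirst X + traceFirst Y := by
  ext a b
  simp [traceFirst, Finset.sum_add_distrib]

lemma traceFirst_smul (c : ℂ) (X : JointOp n k) : traceFirst (c • X) = c • traceFirst X := by
  ext a b
  simp [traceFirst, Finset.mul_sum]

lemma memoryUpdate_add_left (M : JointOp n k) (ρ σ : Op n) (S : Op k) :
    memoryUpdate M (ρ + σ) S = memoryUpdate M ρ S + memoryUpdate M σ S := by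
  simp [memoryUpdate, Matrix.add_kronecker, mul_add, add_mul, traceFirst_add]

lemma memoryUpdate_add_right (M : JointOp n k) (ρ : Op n) (S R : Op k) :
    memoryUpdate M ρ (S + R) = memoryUpdate M ρ S + memoryUpdate M ρ R := by
  simp [memoryUpdate, Matrix.kronecker_add, mul_add, add_mul, traceFirst_add]

lemma memoryUpdate_smul_left (M : JointOp n k) (c : ℂ) (ρ : Op n) (S : Op k) :
    memoryUpdate M (c • ρ) S = c • memoryUpdate M ρ S := by
  simp [memoryUpdate, Matrix.smul_kronecker, traceFirst_smul]

lemma memoryUpdate_smul_right (M : JointOp n k) (ρ : Op n) (c : ℂ) (S : Op k) :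
    memoryUpdate M ρ (c • S) = c • memoryUpdate M ρ S := by
  simp [memoryUpdate, Matrix.kronecker_smul, traceFirst_smul]

lemma traceFirst_conjTranspose (X : JointOp n k) :
    (traceFirst X).conjTranspose = traceFirst X.conjTranspose := by
  ext a b
  simp [traceFirst]

lemma isHermitian_memoryUpdate (M : JointOp n k) {ρ : Op n} {S : Op k} (hρ : ρ.IsHermitian)
    (hS : S.IsHermitian) : (memoryUpdate M ρ S).IsHermitian := by
  unfold Matrix.IsHermitian memoryUpdate
  rw [traceFirst_conjTranspose]
  simp [Matrix.conjTranspose_mul, Matrix.conjTranspose_kronecker, hρ.eq, hS.eq, mul_assoc]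

lemma posSemidef_memoryUpdate (M : JointOp n k) {ρ : Op n} {S : Op k} (hρ : ρ.PosSemidef)
    (hS : S.PosSemidef) : (memoryUpdate M ρ S).PosSemidef := by
  have h := (hρ.kronecker hS).mul_mul_conjTranspose_same M
  have h2 : memoryUpdate M ρ S = ∑ x : Qubits n,
      (M * (ρ ⊗ₖ S) * M.conjTranspose).submatrix (fun a => (x, a)) (fun a => (x, a)) := by
    ext a b
    simp [memoryUpdate, traceFirst, Matrix.sum_apply]
  rw [h2]
  exact Matrix.posSemidef_sum _ fun x _ => h.submatrix _

lemma trace_traceFirst (X : JointOp n k) : (traceFirst X).trace = X.trace := by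
  simp [traceFirst, Matrix.trace, Fintype.sum_prod_type_right]

lemma sum_trace_memoryUpdate {ι : Type*} [Fintype ι] (M : ι → JointOp n k)
    (hM : ∑ s, (M s).conjTranspose * M s = 1) (ρ : Op n) (S : Op k) :
    ∑ s, (memoryUpdate (M s) ρ S).trace = ρ.trace * S.trace := by
  have h : ∀ s, (memoryUpdate (M s) ρ S).trace =
      (((M s).conjTranspose * M s) * (ρ ⊗ₖ S)).trace := by
    intro s
    rw [memoryUpdate, trace_traceFirst, Matrix.trace_mul_comm, mul_assoc]
  simp only [h]
  rw [← Matrix.trace_sum, ← Finset.sum_mul, hM, one_mul, Matrix.trace_kronecker]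

open scoped MatrixOrder Matrix.Norms.L2Operator in
lemma exists_eq_conjTranspose_mul_self {S : Op k} (hS : S.PosSemidef) :
    ∃ R : Op k, S = R.conjTranspose * R :=
  CStarAlgebra.nonneg_iff_eq_star_mul_self.1 hS.nonneg

/-! ### The second moment of the memory update over all Pauli strings -/

lemma norm_sq_eq_mul_star (z : ℂ) : ((‖z‖ ^ 2 : ℝ) : ℂ) = z * star z := by
  simp [Complex.mul_conj, Complex.normSq_eq_norm_sq]

/-- Parseval's identity for the Pauli basis. -/
lemma sum_norm_sq_pauliOp (G : Qubits n × Qubits n → ℂ) :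
    ∑ P : Fin n → Fin 4, ‖∑ p : Qubits n × Qubits n, pauliOp P p.1 p.2 * G p‖ ^ 2 =
      2 ^ n * ∑ p, ‖G p‖ ^ 2 := by
  apply Complex.ofReal_injective
  simp only [Complex.ofReal_sum, Complex.ofReal_mul, norm_sq_eq_mul_star, star_sum, star_mul,
    Finset.sum_mul_sum]
  rw [Finset.sum_comm]
  simp only [Finset.sum_comm (s := (Finset.univ : Finset (Fin n → Fin 4)))]
  have h : ∀ p q : Qubits n × Qubits n,
      ∑ P : Fin n → Fin 4, pauliOp P p.1 p.2 * G p * (star (G q) * star (pauliOp P q.1 q.2)) =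
        if p = q then 2 ^ n * (G p * star (G q)) else 0 := by
    intro p q
    have : ∀ P : Fin n → Fin 4,
        pauliOp P p.1 p.2 * G p * (star (G q) * star (pauliOp P q.1 q.2)) =
          (pauliOp P p.1 p.2 * star (pauliOp P q.1 q.2)) * (G p * star (G q)) := fun P => by ring
    simp only [this, ← Finset.sum_mul, sum_pauliOp_mul_star, Prod.ext_iff, ite_mul, zero_mul]
  simp only [h, Finset.sum_ite_eq, Finset.mem_univ, if_true, Finset.mul_sum]
  simp

lemma norm_sum_mul_star_sq_le {ι : Type*} [Fintype ι] (u v : ι → ℂ) :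
    ‖∑ i, u i * star (v i)‖ ^ 2 ≤ (∑ i, ‖u i‖ ^ 2) * ∑ i, ‖v i‖ ^ 2 := by
  refine le_trans ?_ (Finset.sum_mul_sq_le_sq_mul_sq Finset.univ (fun i => ‖u i‖) fun i => ‖v i‖)
  refine pow_le_pow_left₀ (norm_nonneg _) ((norm_sum_le _ _).trans_eq ?_) 2
  simp

/-- With `S = R†R`, the entries of the update are linear in `ρ` with inner products of vectors `U`
as coefficients. Parseval sums their squares over `P`; Cauchy–Schwarz then splits them into products
of squared lengths `w`, whose total is the trace of the update of the identity. -/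
lemma sum_norm_sq_memoryUpdate_pauliOp_le (M : JointOp n k) {S : Op k} (hS : S.PosSemidef) :
    ∑ P : Fin n → Fin 4, ∑ a, ∑ b, ‖memoryUpdate M (pauliOp P) S a b‖ ^ 2 ≤
      2 ^ n * (memoryUpdate M 1 S).trace.re ^ 2 := by
  obtain ⟨R, rfl⟩ := exists_eq_conjTranspose_mul_self hS
  let U : Qubits k × Qubits n → Qubits n × Qubits k → ℂ := fun p z =>
    ∑ c, M (z.1, p.1) (p.2, c) * star (R z.2 c)
  let w : Qubits k × Qubits n → ℝ := fun p => ∑ z, ‖U p z‖ ^ 2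
  have hK : ∀ (ρ : Op n) (a b : Qubits k), memoryUpdate M ρ (R.conjTranspose * R) a b =
      ∑ p : Qubits n × Qubits n, ρ p.1 p.2 * ∑ z, U (a, p.1) z * star (U (b, p.2) z) := by
    intro ρ a b
    -- Both sides are sums over the same six indices in different orders; collecting them in one
    -- tuple turns the reordering into a bijection.
    let F : Qubits n × Qubits n × Qubits n × Qubits k × Qubits k × Qubits k → ℂ :=
      fun ⟨y, y', x, e, c, c'⟩ =>
        ρ y y' * (M (x, a) (y, c) * star (R e c) * (R e c' * star (M (x, b) (y', c'))))
    calc memoryUpdate M ρ (R.conjTranspose * R) a b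
        = ∑ z : Qubits n × (Qubits n × Qubits k) × (Qubits n × Qubits k) × Qubits k,
            F (z.2.2.1.1, z.2.1.1, z.1, z.2.2.2, z.2.2.1.2, z.2.1.2) := by
          rw [memoryUpdate_apply]
          simp only [F, Fintype.sum_prod_type, Matrix.mul_apply, Matrix.conjTranspose_apply,
            Finset.sum_mul, Finset.mul_sum]
          repeat' refine Finset.sum_congr rfl fun _ _ => ?_
          ring
      _ = ∑ z, F z := Fintype.sum_equiv
          ⟨fun z => (z.2.2.1.1, z.2.1.1, z.1, z.2.2.2, z.2.2.1.2, z.2.1.2),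
            fun z => (z.2.2.1, (z.2.1, z.2.2.2.2.2), (z.1, z.2.2.2.2.1), z.2.2.2.1),
            fun _ => rfl, fun _ => rfl⟩ _ _ fun _ => rfl
      _ = _ := by
          simp only [F, U, star_sum, star_mul, star_star, Finset.mul_sum, Fintype.sum_prod_type]
          iterate 4 refine Finset.sum_congr rfl fun _ _ => ?_
          rw [Finset.sum_comm]
          simp only [Finset.sum_mul, Finset.mul_sum]
  have htr : (memoryUpdate M 1 (R.conjTranspose * R)).trace.re = ∑ p, w p := by
    have h : (memoryUpdate M 1 (R.conjTranspose * R)).trace = ((∑ p, w p : ℝ) : ℂ) := by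
      simp only [w, Complex.ofReal_sum, norm_sq_eq_mul_star, Matrix.trace, Matrix.diag, hK,
        Fintype.sum_prod_type, Matrix.one_apply, ite_mul, one_mul, zero_mul, Finset.sum_ite_eq,
        Finset.mem_univ, if_true]
    rw [h, Complex.ofReal_re]
  calc ∑ P : Fin n → Fin 4, ∑ a, ∑ b,
        ‖memoryUpdate M (pauliOp P) (R.conjTranspose * R) a b‖ ^ 2
      = ∑ a, ∑ b, ∑ P : Fin n → Fin 4,
        ‖memoryUpdate M (pauliOp P) (R.conjTranspose * R) a b‖ ^ 2 := by
        rw [Finset.sum_comm]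
        exact Finset.sum_congr rfl fun a _ => Finset.sum_comm
    _ = ∑ a, ∑ b, 2 ^ n * ∑ p : Qubits n × Qubits n,
        ‖∑ z, U (a, p.1) z * star (U (b, p.2) z)‖ ^ 2 := by
        simp only [hK, sum_norm_sq_pauliOp
          (fun p : Qubits n × Qubits n => ∑ z, U (_, p.1) z * star (U (_, p.2) z))]
    _ ≤ ∑ a, ∑ b, 2 ^ n * ∑ p : Qubits n × Qubits n, w (a, p.1) * w (b, p.2) := by
        gcongr
        exact norm_sum_mul_star_sq_le _ _
    _ = 2 ^ n * (memoryUpdate M 1 (R.conjTranspose * R)).trace.re ^ 2 := by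
        rw [htr, sq, Fintype.sum_prod_type, Finset.sum_mul_sum, Finset.mul_sum]
        simp only [Fintype.sum_prod_type, Finset.mul_sum]
        iterate 2 refine Finset.sum_congr rfl fun _ _ => ?_
        rw [Finset.sum_comm]
        simp only [Finset.sum_mul, Finset.mul_sum]

/-! ### Output probabilities as functionals of the memory state -/

/-- Apply `φ` to `(A - t)^2 ≥ 0`, with `φ (A^2) ≤ tr A^2` and `φ 1 ≤ 2^k`. The free parameter `t` is
optimized only after summing over Pauli strings. -/
lemma le_of_posSemidef_functional (φ : Op k → ℝ) (hadd : ∀ A B, φ (A + B) = φ A + φ B)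
    (hsmul : ∀ (r : ℝ) A, φ ((r : ℂ) • A) = r * φ A) (hnonneg : ∀ A, A.PosSemidef → 0 ≤ φ A)
    (hle : ∀ A, A.PosSemidef → φ A ≤ A.trace.re) {A : Op k} (hA : A.IsHermitian)
    {t : ℝ} (ht : 0 < t) :
    φ A ≤ (∑ a, ∑ b, ‖A a b‖ ^ 2) / (2 * t) + t * 2 ^ k / 2 := by
  have hsq : (A.conjTranspose * A).trace.re = ∑ a, ∑ b, ‖A a b‖ ^ 2 := by
    rw [Finset.sum_comm]
    simp [Matrix.trace, Matrix.mul_apply, ← Complex.normSq_eq_norm_sq, Complex.normSq_apply]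
  have h1 : φ 1 ≤ 2 ^ k := by
    have h := hle 1 Matrix.PosSemidef.one
    rw [Matrix.trace_one] at h
    refine h.trans_eq ?_
    simpa using (by norm_cast : ((2 : ℂ) ^ k).re = 2 ^ k)
  have hB : (A - (t : ℂ) • (1 : Op k)).conjTranspose * (A - (t : ℂ) • (1 : Op k)) =
      A.conjTranspose * A + (((-2 * t : ℝ) : ℂ) • A + ((t ^ 2 : ℝ) : ℂ) • (1 : Op k)) := by
    rw [Matrix.conjTranspose_sub, Matrix.conjTranspose_smul, Matrix.conjTranspose_one, hA.eq]
    simp only [sub_mul, mul_sub, Matrix.smul_mul, Matrix.mul_smul, one_mul, mul_one, smul_smul]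
    push_cast
    simp only [Complex.star_def, Complex.conj_ofReal, neg_smul, neg_mul, two_mul, add_smul, sq]
    abel
  have h2 := hnonneg _ (Matrix.posSemidef_conjTranspose_mul_self (A - (t : ℂ) • (1 : Op k)))
  rw [hB, hadd, hadd, hsmul, hsmul] at h2
  have h3 := hle _ (Matrix.posSemidef_conjTranspose_mul_self A)
  rw [hsq] at h3
  have h4 : φ A * (2 * t) ≤ ∑ a, ∑ b, ‖A a b‖ ^ 2 + t ^ 2 * 2 ^ k := by
    have := mul_le_mul_of_nonneg_left h1 (sq_nonneg t)
    linarith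
  calc φ A ≤ (∑ a, ∑ b, ‖A a b‖ ^ 2 + t ^ 2 * 2 ^ k) / (2 * t) := (le_div_iff₀ (by positivity)).2 h4
    _ = _ := by field_simp

namespace LearningTree

variable (ρ : Op n) (O : NonIdPauli n) (v : ℝ)

lemma probOutput_add {T : ℕ} (L : LearningTree n k T) (S R : Op k) :
    L.probOutput ρ O v (S + R) = L.probOutput ρ O v S + L.probOutput ρ O v R := by
  induction L generalizing S R with
  | leaf m E _ _ answer =>
    simp only [probOutput, ← Finset.sum_add_distrib]
    refine Finset.sum_congr rfl fun j _ => ?_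
    split_ifs <;> simp [mul_add, Matrix.trace_add]
  | node N M _ child ih =>
    simp only [probOutput, memoryUpdate_add_right, ih, Finset.sum_add_distrib]

lemma probOutput_smul {T : ℕ} (L : LearningTree n k T) (r : ℝ) (S : Op k) :
    L.probOutput ρ O v ((r : ℂ) • S) = r * L.probOutput ρ O v S := by
  induction L generalizing S with
  | leaf m E _ _ answer =>
    simp only [probOutput, Finset.mul_sum]
    refine Finset.sum_congr rfl fun j _ => ?_
    split_ifs <;> simp [Matrix.trace_smul]
  | node N M _ child ih =>
    simp only [probOutput, memoryUpdate_smul_right, ih, Finset.mul_sum]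

lemma trace_mul_nonneg {A B : Op k} (hA : A.PosSemidef) (hB : B.PosSemidef) :
    0 ≤ (A * B).trace.re := by
  obtain ⟨R, rfl⟩ := exists_eq_conjTranspose_mul_self hB
  rw [← mul_assoc, Matrix.trace_mul_comm, ← mul_assoc]
  exact (Complex.le_def.1 (hA.mul_mul_conjTranspose_same R).trace_nonneg).1

variable {ρ}

lemma probOutput_nonneg (hρ : ρ.PosSemidef) {T : ℕ} (L : LearningTree n k T) {S : Op k}
    (hS : S.PosSemidef) : 0 ≤ L.probOutput ρ O v S := by
  induction L generalizing S with
  | leaf m E hE _ answer =>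
    simp only [probOutput]
    refine Finset.sum_nonneg fun j _ => ?_
    split_ifs
    · exact trace_mul_nonneg (hE O j) hS
    · exact le_rfl
  | node N M _ child ih =>
    simp only [probOutput]
    exact Finset.sum_nonneg fun s _ => ih s (posSemidef_memoryUpdate _ hρ hS)

/-- Distinct outputs are disjoint events, and each measurement preserves the total trace. -/
lemma probOutput_add_le_trace (hρ : IsDensity ρ) {v w : ℝ} (hvw : v ≠ w) {T : ℕ}
    (L : LearningTree n k T) {S : Op k} (hS : S.PosSemidef) :
    L.probOutput ρ O v S + L.probOutput ρ O w S ≤ S.trace.re := by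
  induction L generalizing S with
  | leaf m E hE hc answer =>
    have h : S.trace.re = ∑ j, (E O j * S).trace.re := by
      rw [← Complex.re_sum, ← Matrix.trace_sum, ← Finset.sum_mul, hc, one_mul]
    simp only [probOutput, ← Finset.sum_add_distrib]
    rw [h]
    refine Finset.sum_le_sum fun j _ => ?_
    have := trace_mul_nonneg (hE O j) hS
    split_ifs with h1 h2 <;> simp_all
  | node N M hM child ih =>
    have h := congrArg Complex.re (sum_trace_memoryUpdate M hM ρ S)
    rw [hρ.2, one_mul, Complex.re_sum] at h
    simp only [probOutput, ← Finset.sum_add_distrib]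
    rw [← h]
    exact Finset.sum_le_sum fun s _ => ih s (posSemidef_memoryUpdate _ hρ.1 hS)

lemma probOutput_le_trace (hρ : IsDensity ρ) {T : ℕ} (L : LearningTree n k T) {S : Op k}
    (hS : S.PosSemidef) : L.probOutput ρ O v S ≤ S.trace.re := by
  have h1 := L.probOutput_add_le_trace O hρ (ne_of_lt (lt_add_one v)) hS
  have h2 := L.probOutput_nonneg O (v + 1) hρ.1 hS
  linarith

end LearningTree

/-! ### The lower bound -/

lemma isDensity_mixedState (n : ℕ) : IsDensity (mixedState n) :=
  ⟨posSemidef_mixedState n, trace_mixedState n⟩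

lemma isDensity_pauliState (P : NonIdPauli n) : IsDensity (pauliState P.1) :=
  ⟨posSemidef_pauliState P.1, trace_pauliState P⟩

lemma card_nonIdPauli (n : ℕ) : (Fintype.card (NonIdPauli n) : ℝ) = (2 ^ n) ^ 2 - 1 := by
  have h : Fintype.card (NonIdPauli n) = 4 ^ n - 1 := by
    rw [Fintype.card_subtype_compl]
    simp
  rw [h, Nat.cast_sub (Nat.one_le_pow _ _ (by norm_num))]
  push_cast
  rw [← pow_mul, mul_comm, pow_mul]
  norm_num

namespace LearningTree

/-- Replacing a maximally mixed copy by `(I + P) / 2^n` in a single round changes the output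
probability little on average over `P`. -/
lemma sum_probOutput_memoryUpdate_le {T : ℕ} (L : LearningTree n k T) (v : ℝ) (M : JointOp n k)
    {S : Op k} (hS : S.PosSemidef) :
    ∑ P : NonIdPauli n, L.probOutput (pauliState P.1) P v
        (memoryUpdate M (((2 : ℂ) ^ n)⁻¹ • pauliOp P.1) S) ≤
      √(2 ^ n * 2 ^ k) * (memoryUpdate M 1 S).trace.re := by
  set w := (memoryUpdate M 1 S).trace.re
  set X := ∑ P : NonIdPauli n, L.probOutput (pauliState P.1) P v
    (memoryUpdate M (pauliOp P.1) S) with hX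
  have hw : 0 ≤ w := (Complex.le_def.1
    (posSemidef_memoryUpdate M Matrix.PosSemidef.one hS).trace_nonneg).1
  have hlin : ∑ P : NonIdPauli n, L.probOutput (pauliState P.1) P v
      (memoryUpdate M (((2 : ℂ) ^ n)⁻¹ • pauliOp P.1) S) = (2 ^ n)⁻¹ * X := by
    rw [hX, Finset.mul_sum]
    refine Finset.sum_congr rfl fun P _ => ?_
    rw [memoryUpdate_smul_left, ← probOutput_smul]
    push_cast
    rfl
  have hcard : (Fintype.card (NonIdPauli n) : ℝ) ≤ (2 ^ n) ^ 2 := by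
    rw [card_nonIdPauli]
    linarith
  have hbound : ∀ t : ℝ, 0 < t →
      X ≤ 2 ^ n * w ^ 2 / (2 * t) + (2 ^ n) ^ 2 * (t * 2 ^ k / 2) := by
    intro t ht
    calc X ≤ ∑ P : NonIdPauli n,
          ((∑ a, ∑ b, ‖memoryUpdate M (pauliOp P.1) S a b‖ ^ 2) / (2 * t) + t * 2 ^ k / 2) := by
          refine Finset.sum_le_sum fun P _ => ?_
          exact le_of_posSemidef_functional (L.probOutput (pauliState P.1) P v)
            (L.probOutput_add _ _ _) (fun r A => L.probOutput_smul _ _ _ r A)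
            (fun A hA => L.probOutput_nonneg _ _ (posSemidef_pauliState _) hA)
            (fun A hA => L.probOutput_le_trace _ _ (isDensity_pauliState P) hA)
            (isHermitian_memoryUpdate M (isHermitian_pauliOp _) hS.1) ht
      _ = (∑ P : NonIdPauli n, ∑ a, ∑ b, ‖memoryUpdate M (pauliOp P.1) S a b‖ ^ 2) / (2 * t) +
          Fintype.card (NonIdPauli n) * (t * 2 ^ k / 2) := by
          rw [Finset.sum_add_distrib, Finset.sum_div, Finset.sum_const, Finset.card_univ,
            nsmul_eq_mul]
      _ ≤ _ := by
          gcongr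
          -- Including the identity string adds a nonnegative term and makes Parseval applicable.
          refine le_trans ?_ (sum_norm_sq_memoryUpdate_pauliOp_le M hS)
          rw [← Fintype.sum_subtype_add_sum_subtype (fun P : Fin n → Fin 4 => P ≠ fun _ => 0)]
          exact le_add_of_nonneg_right (by positivity)
  rw [hlin, inv_mul_le_iff₀ (by positivity)]
  rcases hw.eq_or_lt with h0 | hpos
  -- For `w = 0` only the term linear in `t` survives; this `t` makes it equal to `ε`.
  · rw [← h0] at hbound ⊢
    rw [mul_zero, mul_zero]
    refine le_of_forall_pos_le_add fun ε hε => ?_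
    refine (hbound (2 * ε / ((2 ^ n) ^ 2 * 2 ^ k)) (by positivity)).trans_eq ?_
    field_simp
    ring
  · have hr : 0 < √((2 : ℝ) ^ n * 2 ^ k) := by positivity
    have hr2 : √((2 : ℝ) ^ n * 2 ^ k) ^ 2 = 2 ^ n * 2 ^ k := Real.sq_sqrt (by positivity)
    set r := √((2 : ℝ) ^ n * 2 ^ k)
    -- The choice `t = w / r` balances the two terms of the bound.
    refine (hbound (w / r) (by positivity)).trans_eq ?_
    have h1 : (2 ^ n) ^ 2 * (w / r * 2 ^ k / 2) = 2 ^ n * w * (2 ^ n * 2 ^ k) / (2 * r) := by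
      field_simp
    rw [h1, ← hr2]
    field_simp
    ring

/-- The distinguishing advantage, summed over all Pauli strings, grows at most linearly with the
number of copies. -/
lemma sum_probOutput_sub_le {T : ℕ} (L : LearningTree n k T) (v : ℝ) {S : Op k}
    (hS : S.PosSemidef) :
    ∑ P : NonIdPauli n,
        (L.probOutput (pauliState P.1) P v S - L.probOutput (mixedState n) P v S) ≤
      T * (√(2 ^ n * 2 ^ k) * 2 ^ n) * S.trace.re := by
  induction L generalizing S with
  | leaf m E _ _ answer => simp [probOutput]
  | @node T N M hM child ih =>
    -- Splitting off the current copy first keeps `S` independent of `P`: the first difference is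
    -- the induction hypothesis at a mixed update, the last term the one-round error.
    have hstep : ∀ P : NonIdPauli n,
        (node N M hM child).probOutput (pauliState P.1) P v S -
            (node N M hM child).probOutput (mixedState n) P v S =
          ∑ s, (((child s).probOutput (pauliState P.1) P v (memoryUpdate (M s) (mixedState n) S) -
              (child s).probOutput (mixedState n) P v (memoryUpdate (M s) (mixedState n) S)) +
            (child s).probOutput (pauliState P.1) P v
              (memoryUpdate (M s) (((2 : ℂ) ^ n)⁻¹ • pauliOp P.1) S)) := by
      intro P
      simp only [probOutput]
      rw [← Finset.sum_sub_distrib]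
      refine Finset.sum_congr rfl fun s _ => ?_
      -- The backward rewrite restores the copies used in later rounds.
      conv_lhs => rw [pauliState_eq, memoryUpdate_add_left, ← pauliState_eq, probOutput_add]
      ring
    have h1 : ∑ s, (memoryUpdate (M s) (mixedState n) S).trace.re = S.trace.re := by
      rw [← Complex.re_sum, sum_trace_memoryUpdate M hM, trace_mixedState, one_mul]
    have h2 : ∑ s, (memoryUpdate (M s) 1 S).trace.re = 2 ^ n * S.trace.re := by
      rw [← Complex.re_sum, sum_trace_memoryUpdate M hM, Matrix.trace_one]
      have : ((Fintype.card (Qubits n) : ℕ) : ℂ) = ((2 ^ n : ℝ) : ℂ) := by simp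
      rw [this, Complex.re_ofReal_mul]
    simp only [hstep]
    rw [Finset.sum_comm]
    simp only [Finset.sum_add_distrib]
    calc _ ≤ ∑ s, T * (√(2 ^ n * 2 ^ k) * 2 ^ n) *
            (memoryUpdate (M s) (mixedState n) S).trace.re +
          ∑ s, √(2 ^ n * 2 ^ k) * (memoryUpdate (M s) 1 S).trace.re := by
          gcongr with s _ s _
          · exact ih s (posSemidef_memoryUpdate _ (posSemidef_mixedState n) hS)
          · exact (child s).sum_probOutput_memoryUpdate_le v (M s) hS
      _ = _ := by
          rw [← Finset.mul_sum, ← Finset.mul_sum, h1, h2]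
          push_cast
          ring

end LearningTree

lemma norm_trace_pauliOp_mul_mixedState (O : NonIdPauli n) :
    ‖(pauliOp O.1 * mixedState n).trace‖ = 0 := by
  simp [mixedState, Matrix.trace_smul, trace_pauliOp]

lemma norm_trace_pauliOp_mul_pauliState (P : NonIdPauli n) :
    ‖(pauliOp P.1 * pauliState P.1).trace‖ = 1 := by
  simp [pauliState, mul_add, Matrix.trace_smul, Matrix.trace_add, trace_pauliOp, trace_pauliOp_mul]

lemma successProb_eq {T : ℕ} (A : LearningAlgorithm n k T) :
    A.successProb = 1 / 2 * ((∑ O : NonIdPauli n, A.tree.probOutput (mixedState n) O 0 A.init) /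
        Fintype.card (NonIdPauli n)) +
      1 / 2 * ((∑ P : NonIdPauli n, A.tree.probOutput (pauliState P.1) P 1 A.init) /
        Fintype.card (NonIdPauli n)) := by
  simp only [LearningAlgorithm.successProb, LearningAlgorithm.probCorrect,
    norm_trace_pauliOp_mul_mixedState, norm_trace_pauliOp_mul_pauliState]

lemma sqrt_le_of_two_thirds_le_successProb (hn : 1 ≤ n) {T : ℕ} (A : LearningAlgorithm n k T)
    (h : 2 / 3 ≤ A.successProb) : 2 ^ n ≤ 4 * T * √(2 ^ n * 2 ^ k) := by
  have hd : (2 : ℝ) ≤ 2 ^ n := le_self_pow₀ one_le_two (by omega)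
  have hN : (Fintype.card (NonIdPauli n) : ℝ) = (2 ^ n) ^ 2 - 1 := card_nonIdPauli n
  have hNpos : (0 : ℝ) < Fintype.card (NonIdPauli n) := by rw [hN]; nlinarith
  have hS := A.init_isDensity
  have h1 := A.tree.sum_probOutput_sub_le 1 hS.1
  have h2 : ∑ O : NonIdPauli n, A.tree.probOutput (mixedState n) O 0 A.init +
      ∑ O : NonIdPauli n, A.tree.probOutput (mixedState n) O 1 A.init ≤
        Fintype.card (NonIdPauli n) := by
    rw [← Finset.sum_add_distrib]
    refine (Finset.sum_le_card_nsmul _ _ 1 fun O _ => ?_).trans_eq (by simp)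
    refine (A.tree.probOutput_add_le_trace O (isDensity_mixedState n) zero_ne_one hS.1).trans_eq ?_
    simp [hS.2]
  rw [Finset.sum_sub_distrib, hS.2, Complex.one_re, mul_one] at h1
  rw [successProb_eq, ← mul_add, ← add_div, ← mul_div_assoc, le_div_iff₀ hNpos] at h
  -- Success `2/3` makes the two averaged probabilities sum to at least `4/3`; disjointness of the
  -- outputs `0` and `1` leaves an advantage of at least `1/3` for output `1`.
  have h3 : ((2 : ℝ) ^ n) ^ 2 - 1 ≤ 3 * (T * (√(2 ^ n * 2 ^ k) * 2 ^ n)) := by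
    rw [← hN]
    linarith
  -- The constant rises from `3` to `4` to absorb the `-1`, using `2^n ≥ 2`.
  have h4 : (2 : ℝ) ^ n * 2 ^ n ≤ 2 ^ n * (4 * T * √(2 ^ n * 2 ^ k)) := by nlinarith
  exact le_of_mul_le_mul_left h4 (by positivity)

theorem copies_lower_bound (hn : 1 ≤ n) {T : ℕ} (A : LearningAlgorithm n k T)
    (h : 2 / 3 ≤ A.successProb) :
    1 / 4 * (2 : ℝ) ^ (((n : ℝ) - (k : ℝ)) / 3) ≤ (T : ℝ) := by
  have hlow := sqrt_le_of_two_thirds_le_successProb hn A h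
  have hT : (1 : ℝ) ≤ T := by
    rcases Nat.eq_zero_or_pos T with h0 | hpos
    · rw [h0, Nat.cast_zero, mul_zero, zero_mul] at hlow
      exact absurd hlow (not_le.2 (by positivity))
    · exact_mod_cast hpos
  rcases le_total (n : ℝ) k with hnk | hkn
  · have : (2 : ℝ) ^ (((n : ℝ) - (k : ℝ)) / 3) ≤ 1 :=
      Real.rpow_le_one_of_one_le_of_nonpos one_le_two (by linarith)
    linarith
  -- Weakening the exponent `1/2` to `1/3` needs `k ≤ n`; the other case used only `T ≥ 1`.
  · have hle : (2 : ℝ) ^ (((n : ℝ) - (k : ℝ)) / 3) ≤ (2 : ℝ) ^ (((n : ℝ) - (k : ℝ)) / 2) :=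
      Real.rpow_le_rpow_of_exponent_le one_le_two (by linarith)
    have hsqrt : √((2 : ℝ) ^ n * 2 ^ k) = 2 ^ (((n : ℝ) + k) / 2) := by
      rw [Real.sqrt_eq_rpow, ← pow_add, ← Real.rpow_natCast, ← Real.rpow_mul two_pos.le]
      push_cast
      ring_nf
    have hmul : (2 : ℝ) ^ (((n : ℝ) - (k : ℝ)) / 2) * 2 ^ (((n : ℝ) + k) / 2) = 2 ^ n := by
      rw [← Real.rpow_add two_pos, ← Real.rpow_natCast]
      ring_nf
    rw [hsqrt, ← hmul] at hlow
    have := le_of_mul_le_mul_right hlow (by positivity)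
    linarith

/-! ### Bell measurements -/

/-- The overlap `d ⟨B_Q|ρ ⊗ σ|B_Q⟩` with the Bell state `B_Q = d^{-1/2} ∑ Q y x |x⟩|y⟩`. -/
def bellForm (ρ σ : Op n) (Q : Fin n → Fin 4) : ℂ :=
  ∑ x, ∑ y, ∑ x', ∑ y', star (pauliOp Q y x) * (ρ x x' * σ y y') * pauliOp Q y' x'

lemma bellForm_add_left (ρ ρ' σ : Op n) (Q : Fin n → Fin 4) :
    bellForm (ρ + ρ') σ Q = bellForm ρ σ Q + bellForm ρ' σ Q := by
  simp only [bellForm, ← Finset.sum_add_distrib, Matrix.add_apply]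
  iterate 4 refine Finset.sum_congr rfl fun _ _ => ?_
  ring

lemma bellForm_add_right (ρ σ σ' : Op n) (Q : Fin n → Fin 4) :
    bellForm ρ (σ + σ') Q = bellForm ρ σ Q + bellForm ρ σ' Q := by
  simp only [bellForm, ← Finset.sum_add_distrib, Matrix.add_apply]
  iterate 4 refine Finset.sum_congr rfl fun _ _ => ?_
  ring

lemma bellForm_smul_left (c : ℂ) (ρ σ : Op n) (Q : Fin n → Fin 4) :
    bellForm (c • ρ) σ Q = c * bellForm ρ σ Q := by
  simp only [bellForm, Finset.mul_sum, Matrix.smul_apply, smul_eq_mul]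
  iterate 4 refine Finset.sum_congr rfl fun _ _ => ?_
  ring

lemma bellForm_smul_right (c : ℂ) (ρ σ : Op n) (Q : Fin n → Fin 4) :
    bellForm ρ (c • σ) Q = c * bellForm ρ σ Q := by
  simp only [bellForm, Finset.mul_sum, Matrix.smul_apply, smul_eq_mul]
  iterate 4 refine Finset.sum_congr rfl fun _ _ => ?_
  ring

/-- The single-qubit case of `bellForm` on Pauli matrices. -/
def bellPauli (p p' q : Fin 4) : ℂ :=
  ∑ a, ∑ b, ∑ a', ∑ b', star (pauli q b a) * (pauli p a a' * pauli p' b b') * pauli q b' a'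

lemma bellForm_pauliOp (P P' Q : Fin n → Fin 4) :
    bellForm (pauliOp P) (pauliOp P') Q = ∏ i, bellPauli (P i) (P' i) (Q i) := by
  let f : Fin n → Fin 2 → Fin 2 → Fin 2 → Fin 2 → ℂ := fun i a b a' b' =>
    star (pauli (Q i) b a) * (pauli (P i) a a' * pauli (P' i) b b') * pauli (Q i) b' a'
  have h : bellForm (pauliOp P) (pauliOp P') Q =
      ∑ x : Qubits n, ∑ y : Qubits n, ∑ x' : Qubits n, ∑ y' : Qubits n,
        ∏ i, f i (x i) (y i) (x' i) (y' i) := by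
    simp only [bellForm, pauliOp, Matrix.of_apply, star_prod, ← Finset.prod_mul_distrib, f]
  rw [h]
  have h4 : ∀ x y x' : Qubits n, ∑ y' : Qubits n, ∏ i, f i (x i) (y i) (x' i) (y' i) =
      ∏ i, ∑ b', f i (x i) (y i) (x' i) b' := fun x y x' =>
    sum_prod_apply fun i b' => f i (x i) (y i) (x' i) b'
  have h3 : ∀ x y : Qubits n, ∑ x' : Qubits n, ∏ i, ∑ b', f i (x i) (y i) (x' i) b' =
      ∏ i, ∑ a', ∑ b', f i (x i) (y i) a' b' := fun x y =>
    sum_prod_apply fun i a' => ∑ b', f i (x i) (y i) a' b'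
  have h2 : ∀ x : Qubits n, ∑ y : Qubits n, ∏ i, ∑ a', ∑ b', f i (x i) (y i) a' b' =
      ∏ i, ∑ b, ∑ a', ∑ b', f i (x i) b a' b' := fun x =>
    sum_prod_apply fun i b => ∑ a', ∑ b', f i (x i) b a' b'
  simp only [h4, h3, h2]
  exact sum_prod_apply fun i a => ∑ b, ∑ a', ∑ b', f i a b a' b'

/-- The sum is `tr(q† p' q pᵀ)`; conjugation and transposition change Pauli matrices only by signs,
so this is `± tr(p' p)`. -/
lemma bellPauli_of_ne {p p' : Fin 4} (h : p ≠ p') (q : Fin 4) : bellPauli p p' q = 0 := by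
  fin_cases p <;> fin_cases p' <;> first | exact absurd rfl h | skip
  all_goals fin_cases q <;> simp [bellPauli, pauli]

lemma bellPauli_self_sq (p q : Fin 4) : bellPauli p p q ^ 2 = 2 ^ 2 := by
  fin_cases p <;> fin_cases q <;> simp [bellPauli, pauli] <;> norm_num

lemma bellPauli_zero_zero (q : Fin 4) : bellPauli 0 0 q = 2 := by
  fin_cases q <;> simp [bellPauli, pauli] <;> norm_num

lemma sum_bellPauli {p : Fin 4} (hp : p ≠ 0) : ∑ q, bellPauli p p q = 0 := by
  fin_cases p <;> first | exact absurd rfl hp | skip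
  all_goals simp [bellPauli, pauli, Fin.sum_univ_four] <;> norm_num

lemma bellForm_pauliOp_of_ne {P P' : Fin n → Fin 4} (h : P ≠ P') (Q : Fin n → Fin 4) :
    bellForm (pauliOp P) (pauliOp P') Q = 0 := by
  obtain ⟨i, hi⟩ := Function.ne_iff.1 h
  rw [bellForm_pauliOp]
  exact Finset.prod_eq_zero (Finset.mem_univ i) (bellPauli_of_ne hi _)

lemma bellForm_one_one (Q : Fin n → Fin 4) : bellForm 1 1 Q = 2 ^ n := by
  rw [← pauliOp_zero, bellForm_pauliOp]
  simp [bellPauli_zero_zero]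

lemma bellForm_pauliOp_self (P Q : Fin n → Fin 4) :
    bellForm (pauliOp P) (pauliOp P) Q = 2 ^ n ∨ bellForm (pauliOp P) (pauliOp P) Q = -2 ^ n := by
  rw [← sq_eq_sq_iff_eq_or_eq_neg, bellForm_pauliOp, ← Finset.prod_pow]
  simp only [bellPauli_self_sq, Finset.prod_const, Finset.card_univ, Fintype.card_fin]
  rw [← pow_mul, ← pow_mul, mul_comm]

/-- Up to a scalar this is the trace of `O ⊗ O` in the Bell basis; a site where `O` is not the
identity contributes a zero factor. -/
lemma sum_bellForm_pauliOp_self (O : NonIdPauli n) :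
    ∑ Q, bellForm (pauliOp O.1) (pauliOp O.1) Q = 0 := by
  simp only [bellForm_pauliOp]
  rw [sum_prod_apply fun i q => bellPauli (O.1 i) (O.1 i) q]
  obtain ⟨i, hi⟩ := Function.ne_iff.1 O.2
  exact Finset.prod_eq_zero (Finset.mem_univ i) (sum_bellPauli hi)

lemma sum_pauliString_one {R : Type*} [CommSemiring R] :
    ∑ _Q : Fin n → Fin 4, (1 : R) = (2 ^ n) ^ 2 := by
  rw [← pow_mul, mul_comm, pow_mul]
  simp only [Finset.sum_const, Finset.card_univ, Fintype.card_fun, Fintype.card_fin, nsmul_eq_mul,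
    mul_one, Nat.cast_pow]
  norm_num

/-- The Bell state `B_Q` is an eigenvector of `O ⊗ O` with eigenvalue `1`. -/
def BellStabilized (Q : Fin n → Fin 4) (O : NonIdPauli n) : Prop :=
  bellForm (pauliOp O.1) (pauliOp O.1) Q = 2 ^ n

open Classical in
/-- Every non-identity Pauli string stabilizes half of the Bell states. -/
lemma sum_bellStabilized (O : NonIdPauli n) :
    ∑ Q, (if BellStabilized Q O then (1 : ℝ) else 0) = (2 ^ n) ^ 2 / 2 := by
  have h : ∀ Q, bellForm (pauliOp O.1) (pauliOp O.1) Q =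
      2 ^ n * (2 * ((if BellStabilized Q O then (1 : ℝ) else 0 : ℝ) : ℂ) - 1) := by
    intro Q
    by_cases hQ : BellStabilized Q O
    · rw [if_pos hQ]
      refine Eq.trans hQ ?_
      push_cast
      ring
    · rw [if_neg hQ, (bellForm_pauliOp_self O.1 Q).resolve_left hQ]
      push_cast
      ring
  have hs := sum_bellForm_pauliOp_self O
  simp only [h] at hs
  rw [← Finset.mul_sum, Finset.sum_sub_distrib, ← Finset.mul_sum, mul_eq_zero] at hs
  have hs := hs.resolve_left (by positivity)
  rw [sum_pauliString_one] at hs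
  apply Complex.ofReal_injective
  push_cast at hs ⊢
  linear_combination hs / 2

lemma bellForm_mixedState (Q : Fin n → Fin 4) :
    ((2 : ℂ) ^ n)⁻¹ * bellForm (mixedState n) (mixedState n) Q =
      ((((2 ^ n) ^ 2)⁻¹ : ℝ) : ℂ) := by
  rw [mixedState, bellForm_smul_left, bellForm_smul_right, bellForm_one_one]
  push_cast
  field_simp

/-- The cross terms `I ⊗ O` and `O ⊗ I` vanish, leaving `1 + (-1)` from `I ⊗ I` and `O ⊗ O`. -/
lemma bellForm_pauliState_eq_zero {O : NonIdPauli n} {Q : Fin n → Fin 4}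
    (h : ¬ BellStabilized Q O) : bellForm (pauliState O.1) (pauliState O.1) Q = 0 := by
  have h1 : bellForm (1 : Op n) (pauliOp O.1) Q = 0 := by
    rw [← pauliOp_zero]
    exact bellForm_pauliOp_of_ne O.2.symm Q
  have h2 : bellForm (pauliOp O.1) (1 : Op n) Q = 0 := by
    rw [← pauliOp_zero]
    exact bellForm_pauliOp_of_ne O.2 Q
  rw [pauliState, bellForm_smul_left, bellForm_smul_right, bellForm_add_left, bellForm_add_right,
    bellForm_add_right, h1, h2, bellForm_one_one, (bellForm_pauliOp_self O.1 Q).resolve_left h]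
  ring

/-- The operator `|0⟩⟨B_Q|`. -/
def bellOp (Q : Fin n → Fin 4) : JointOp n n :=
  Matrix.of fun p q => if p = 0 then ((√(2 ^ n))⁻¹ : ℝ) * star (pauliOp Q q.2 q.1) else 0

lemma inv_sqrt_mul_inv_sqrt :
    (((√(2 ^ n))⁻¹ : ℝ) : ℂ) * (((√(2 ^ n))⁻¹ : ℝ) : ℂ) = ((2 : ℂ) ^ n)⁻¹ := by
  rw [← Complex.ofReal_mul, ← mul_inv, Real.mul_self_sqrt (by positivity)]
  push_cast
  rfl

lemma sum_bellOp : ∑ Q : Fin n → Fin 4, (bellOp Q).conjTranspose * bellOp Q = 1 := by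
  ext p q
  have h : ∀ Q : Fin n → Fin 4, ((bellOp Q).conjTranspose * bellOp Q) p q =
      ((2 : ℂ) ^ n)⁻¹ * (pauliOp Q p.2 p.1 * star (pauliOp Q q.2 q.1)) := by
    intro Q
    rw [Matrix.mul_apply, Finset.sum_eq_single 0]
    · rw [← inv_sqrt_mul_inv_sqrt]
      simp only [Matrix.conjTranspose_apply, bellOp, Matrix.of_apply, if_true, star_mul,
        Complex.star_def, Complex.conj_ofReal, Complex.conj_conj]
      ring
    · intro r _ hr
      simp [bellOp, hr]
    · simp
  rw [Matrix.sum_apply]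
  simp only [h, ← Finset.mul_sum, sum_pauliOp_mul_star, Matrix.one_apply, Prod.ext_iff,
    and_comm (a := p.2 = q.2)]
  split_ifs <;> simp

lemma trace_memoryUpdate_bellOp (Q : Fin n → Fin 4) (ρ S : Op n) :
    (memoryUpdate (bellOp Q) ρ S).trace = ((2 : ℂ) ^ n)⁻¹ * bellForm ρ S Q := by
  have h : (memoryUpdate (bellOp Q) ρ S).trace =
      (bellOp Q * (ρ ⊗ₖ S) * (bellOp Q).conjTranspose) 0 0 := by
    rw [memoryUpdate, trace_traceFirst, Matrix.trace, Finset.sum_eq_single 0]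
    · rfl
    · intro r _ hr
      simp [Matrix.mul_apply, bellOp, hr]
    · simp
  rw [h, Matrix.mul_apply]
  simp only [Matrix.mul_apply, Finset.sum_mul, bellForm]
  rw [Finset.sum_comm]
  simp only [Fintype.sum_prod_type, Finset.mul_sum]
  iterate 4 refine Finset.sum_congr rfl fun _ _ => ?_
  rw [← inv_sqrt_mul_inv_sqrt]
  simp only [Matrix.conjTranspose_apply, bellOp, Matrix.of_apply, if_true, star_mul,
    Complex.star_def, Complex.conj_ofReal, Complex.conj_conj, Matrix.kroneckerMap_apply]
  ring

/-- The exchange of the incoming copy and the memory. -/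
def swapOp (n : ℕ) : JointOp n n := Matrix.of fun p q => if p.1 = q.2 ∧ p.2 = q.1 then 1 else 0

lemma swapOp_conjTranspose_mul_self : (swapOp n).conjTranspose * swapOp n = 1 := by
  ext p q
  rw [Matrix.mul_apply, Finset.sum_eq_single p.swap]
  · simp [swapOp, Matrix.one_apply, Prod.ext_iff, and_comm]
  · intro r _ hr
    have : ¬ (r.1 = p.2 ∧ r.2 = p.1) := fun h => hr (Prod.ext h.1 h.2)
    simp [swapOp, this]
  · simp

lemma memoryUpdate_swapOp (ρ S : Op n) : memoryUpdate (swapOp n) ρ S = S.trace • ρ := by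
  ext a b
  simp only [memoryUpdate_apply, swapOp, Matrix.of_apply, Fintype.sum_prod_type, ite_and, ite_mul,
    one_mul, zero_mul, apply_ite star, star_one, star_zero, mul_ite, mul_one, mul_zero,
    Matrix.smul_apply, Matrix.trace, Matrix.diag,
    smul_eq_mul, Finset.sum_mul]
  simp [mul_comm]

/-! ### The algorithm with `n` qubits of memory -/

open Classical in
/-- `m` Bell measurements, each on two consecutive copies. The output is `1` if `O` is a candidate
from the start and all the observed Bell states are stabilized by `O ⊗ O`, and `0` otherwise. -/
def bellTree : (m : ℕ) → (NonIdPauli n → Prop) → LearningTree n n (2 * m)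
  | 0, h => .leaf 1 (fun _ _ => 1) (fun _ _ => Matrix.PosSemidef.one) (by simp)
      (fun O _ => if h O then 1 else 0)
  | m + 1, h => .node 1 (fun _ => swapOp n) (by simp [swapOp_conjTranspose_mul_self]) fun _ =>
      .node (Fintype.card (Fin n → Fin 4)) (fun s => bellOp ((Fintype.equivFin _).symm s))
        ((Equiv.sum_comp (Fintype.equivFin (Fin n → Fin 4)).symm
          fun Q => (bellOp Q).conjTranspose * bellOp Q).trans sum_bellOp)
        fun s => bellTree m fun O => h O ∧ BellStabilized ((Fintype.equivFin _).symm s) O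

/-- The swap overwrites the memory with a fresh copy, so each pair of rounds depends on the old
memory only through its trace. -/
lemma probOutput_bellTree_succ (m : ℕ) (h : NonIdPauli n → Prop) (ρ : Op n) (O : NonIdPauli n)
    (v : ℝ) (S : Op n) :
    (bellTree (m + 1) h).probOutput ρ O v S =
      ∑ Q, (bellTree m fun O => h O ∧ BellStabilized Q O).probOutput ρ O v
        (memoryUpdate (bellOp Q) ρ (S.trace • ρ)) := by
  rw [← Equiv.sum_comp (Fintype.equivFin (Fin n → Fin 4)).symm]
  simp only [bellTree]
  simp only [LearningTree.probOutput, Finset.univ_unique, Finset.sum_singleton,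
    memoryUpdate_swapOp]

open Classical in
lemma probOutput_bellTree_pauliState (O : NonIdPauli n) (m : ℕ) (h : NonIdPauli n → Prop)
    (S : Op n) :
    (bellTree m h).probOutput (pauliState O.1) O 1 S = if h O then S.trace.re else 0 := by
  induction m generalizing h S with
  | zero => by_cases hO : h O <;> simp [bellTree, LearningTree.probOutput, hO]
  | succ m ih =>
    rw [probOutput_bellTree_succ]
    simp only [ih]
    by_cases hO : h O
    · have hs : S.trace.re = ∑ Q : Fin n → Fin 4,
          (memoryUpdate (bellOp Q) (pauliState O.1) (S.trace • pauliState O.1)).trace.re := by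
        rw [← Complex.re_sum, sum_trace_memoryUpdate _ sum_bellOp, Matrix.trace_smul,
          trace_pauliState, smul_eq_mul, one_mul, mul_one]
      rw [if_pos hO, hs]
      refine Finset.sum_congr rfl fun Q _ => ?_
      by_cases hQ : BellStabilized Q O
      · rw [if_pos ⟨hO, hQ⟩]
      · rw [if_neg fun h => hQ h.2, trace_memoryUpdate_bellOp, bellForm_smul_right,
          bellForm_pauliState_eq_zero hQ]
        simp
    · simp [hO]

open Classical in
-- Bell outcomes are uniform and half of them eliminate `O`, so a candidate survives all `m` pairs
-- with probability `2^(-m)`.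
lemma probOutput_bellTree_mixedState (O : NonIdPauli n) (m : ℕ) (h : NonIdPauli n → Prop)
    (S : Op n) :
    (bellTree m h).probOutput (mixedState n) O 0 S =
      if h O then S.trace.re * (1 - (1 / 2) ^ m) else S.trace.re := by
  induction m generalizing h S with
  | zero => by_cases hO : h O <;> simp [bellTree, LearningTree.probOutput, hO]
  | succ m ih =>
    have hS : ∀ Q : Fin n → Fin 4,
        (memoryUpdate (bellOp Q) (mixedState n) (S.trace • mixedState n)).trace.re =
          S.trace.re * ((2 ^ n) ^ 2)⁻¹ := by
      intro Q
      rw [trace_memoryUpdate_bellOp, bellForm_smul_right, mul_left_comm, bellForm_mixedState,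
        Complex.re_mul_ofReal]
    rw [probOutput_bellTree_succ]
    simp only [ih, hS]
    have hterm : ∀ Q : Fin n → Fin 4,
        (if h O ∧ BellStabilized Q O then S.trace.re * ((2 ^ n) ^ 2)⁻¹ * (1 - (1 / 2) ^ m)
          else S.trace.re * ((2 ^ n) ^ 2)⁻¹) =
        S.trace.re * ((2 ^ n) ^ 2)⁻¹ * (1 - (if h O then (1 / 2) ^ m else 0) *
          if BellStabilized Q O then 1 else 0) := by
      intro Q
      by_cases hO : h O <;> by_cases hQ : BellStabilized Q O <;> simp [hO, hQ]
    simp only [hterm]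
    rw [← Finset.mul_sum, Finset.sum_sub_distrib, ← Finset.mul_sum, sum_bellStabilized, sum_pauliString_one]
    split_ifs
    · field_simp
      ring
    · field_simp
      ring

theorem exists_algorithm {δ : ℝ} (hδ : 0 < δ) :
    ∃ T : ℕ, ∀ n : ℕ, 1 ≤ n → ∃ A : LearningAlgorithm n n T, 1 - δ ≤ A.successProb := by
  obtain ⟨m, hm⟩ := exists_pow_lt_of_lt_one hδ (one_half_lt_one (α := ℝ))
  refine ⟨2 * m, fun n hn => ⟨⟨mixedState n, isDensity_mixedState n, bellTree m fun _ => True⟩, ?_⟩⟩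
  have hd : (2 : ℝ) ≤ 2 ^ n := le_self_pow₀ one_le_two (by omega)
  have hN : (0 : ℝ) < Fintype.card (NonIdPauli n) := by
    rw [card_nonIdPauli]
    nlinarith
  rw [successProb_eq]
  simp only [probOutput_bellTree_mixedState, probOutput_bellTree_pauliState, if_true,
    trace_mixedState, Complex.one_re, one_mul, Finset.sum_const, Finset.card_univ, nsmul_eq_mul,
    mul_one]
  rw [mul_div_cancel_left₀ _ hN.ne', div_self hN.ne']
  have : (0 : ℝ) ≤ (1 / 2) ^ m := by positivity
  linarith

end ShadowTomography

end

theorem mainTheorem6 :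
    (∃ c : ℝ, 0 < c ∧
      ∀ n k T : ℕ, 1 ≤ n →
        ∀ A : ShadowTomography.LearningAlgorithm n k T,
          2 / 3 ≤ A.successProb →
            c * (2 : ℝ) ^ (((n : ℝ) - (k : ℝ)) / 3) ≤ (T : ℝ)) ∧
    (∀ δ : ℝ, 0 < δ →
      ∃ T : ℕ, ∀ n : ℕ, 1 ≤ n →
        ∃ A : ShadowTomography.LearningAlgorithm n n T, 1 - δ ≤ A.successProb) :=
  ⟨⟨1 / 4, by norm_num, fun _ _ _ hn A h => ShadowTomography.copies_lower_bound hn A h⟩,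
    fun _ hδ => ShadowTomography.exists_algorithm hδ⟩
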